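/- Let $P$ be a non-empty finite subset of $[0,1)^3$ and let $S=P+\mathbb Z^3$ be the corresponding periodic point set. For a periodic set $S'\subset\mathbb R^3$, a tetrahedron with affinely independent vertices in $S'$ is a *Delaunay tetrahedron* of $S'$ if no point of $S'$ lies inside its circumsphere; the Delaunay mesh of $S'$ consists of these tetrahedra. The *radius-edge ratio* of a tetrahedron is its circumradius divided by the length of its shortest edge. Fix a threshold $\beta>1$ (for instance $\beta=\sqrt2$); a tetrahedron is *bad* if its radius-edge ratio exceeds $\beta$. *Sequential (Shewchuk) refinement* repeatedly inserts the circumcenter of some bad Delaunay tetrahedron, together with all its integer translates, until no Delaunay tetrahedron is bad. *Parallel Shewchuk refinement.* Let $L$ be given and let $s_0$ be the length of the shortest edge of the initial Delaunay mesh. A tetrahedron is in class $i\ge1$ if its shortest edge has length in $[\beta^{i-1}s_0,\beta^i s_0)$. Two circumspheres *conflict* if each has the other's center in its interior. For $i=1,\dots,\lceil\log_\beta(L/s_0)\rceil$ in turn, do the following: as long as there are bad Delaunay tetrahedra in class $i$, choose any $\mathbb Z^3$-periodic maximal set of pairwise non-conflicting circumspheres of such tetrahedra and insert all their centers at once. Each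 such simultaneous insertion is one iteration. **Theorem.** For every $\beta>1$ there is a constant $C>0$, depending only on $\beta$, such that the following holds. Let $P$ and $S$ be as above, let $L$ be an upper bound for the diameter of $P$ and for the circumradii of the Delaunay tetrahedra of $S$, and let $s$ be the length of the shortest edge in a mesh generated from $S$ by sequential Shewchuk refinement. Then every execution of parallel Shewchuk refinement on $S$ terminates, after at most $C\log^2(L/s)$ iterations, and the resulting Delaunay mesh has all radius-edge ratios at most $\beta$. -/

import Mathlib

noncomputable section

namespace DelaunayRefinement

/-- Three-dimensional Euclidean space. -/
abbrev E3 : Type := EuclideanSpace ℝ (Fin 3)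

/-- A tetrahedron: four affinely independent points. Its circumscribed sphere, circumcenter and
circumradius are Mathlib's `circumsphere`, `circumcenter` and `circumradius`. -/
abbrev Tetrahedron : Type := Affine.Simplex ℝ E3 3

/-- The half-open unit cube `[0,1)³`. -/
def unitCube : Set E3 := {x | ∀ k, x k ∈ Set.Ico (0 : ℝ) 1}

/-- The integer vectors `ℤ³`. -/
def integerVectors : Set E3 := {v | ∀ k, ∃ n : ℤ, v k = n}

/-- The set `P + ℤ³`. -/
def periodize (P : Set E3) : Set E3 := {x | ∃ p ∈ P, ∃ v ∈ integerVectors, x = p + v}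

/-- The lengths of the six edges of a tetrahedron. -/
def edgeLengths (T : Tetrahedron) : Set ℝ :=
  {l | ∃ i j : Fin 4, i ≠ j ∧ l = dist (T.points i) (T.points j)}

/-- The length of the shortest edge of a tetrahedron. -/
def shortestEdge (T : Tetrahedron) : ℝ := sInf (edgeLengths T)

/-- `T` is a Delaunay tetrahedron of `S`: its vertices lie in `S` and the interior of its
circumscribed sphere contains no point of `S`. -/
def IsDelaunay (S : Set E3) (T : Tetrahedron) : Prop :=
  (∀ i, T.points i ∈ S) ∧ ∀ p ∈ S, T.circumradius ≤ dist p T.circumcenter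

/-- The lengths of the edges of the Delaunay mesh of `S`. -/
def meshEdgeLengths (S : Set E3) : Set ℝ := {l | ∃ T, IsDelaunay S T ∧ l ∈ edgeLengths T}

/-- `T` is bad for the threshold `β`: its radius-edge ratio (circumradius divided by the length of
its shortest edge) exceeds `β`. -/
def IsBad (β : ℝ) (T : Tetrahedron) : Prop := β < T.circumradius / shortestEdge T

/-- All radius-edge ratios in the Delaunay mesh of `S` are at most `β`. -/
def HasRadiusEdgeBound (β : ℝ) (S : Set E3) : Prop :=
  ∀ T, IsDelaunay S T → T.circumradius / shortestEdge T ≤ β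

/-- One step of sequential Delaunay refinement of a periodic point set: the circumcenter of one bad
Delaunay tetrahedron is inserted, together with its integer translates. -/
inductive SequentialStep (β : ℝ) : Set E3 → Set E3 → Prop
  | insert (S : Set E3) (T : Tetrahedron) (hT : IsDelaunay S T) (hbad : IsBad β T) :
      SequentialStep β S (S ∪ periodize {T.circumcenter})

/-- `M` is the vertex set of a mesh generated by sequential refinement starting from `S`: it is
reached by finitely many insertions, and no bad tetrahedron remains. -/
def SequentiallyGenerates (β : ℝ) (S M : Set E3) : Prop :=
  Relation.ReflTransGen (SequentialStep β) S M ∧ ¬ ∃ T, IsDelaunay M T ∧ IsBad β T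

/-- The candidates of class `i`: circumscribed spheres of the bad Delaunay tetrahedra whose shortest
edge has length in `[β ^ i * s, β ^ (i + 1) * s)`. (Classes are numbered from `0`.) -/
def candidates (β s : ℝ) (i : ℕ) (S : Set E3) : Set (EuclideanGeometry.Sphere E3) :=
  {c | ∃ T, IsDelaunay S T ∧ IsBad β T ∧
    shortestEdge T ∈ Set.Ico (β ^ i * s) (β ^ (i + 1) * s) ∧ c = T.circumsphere}

/-- Two spheres conflict if each has the center of the other in its interior. -/
def Conflicting (c d : EuclideanGeometry.Sphere E3) : Prop :=
  dist c.center d.center < c.radius ∧ dist c.center d.center < d.radius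

/-- `I` is a maximal set of pairwise independent (that is, non-conflicting) members of `C`. -/
def IsMaximalIndependent (C I : Set (EuclideanGeometry.Sphere E3)) : Prop :=
  Maximal (fun J => J ⊆ C ∧ J.Pairwise fun c d => ¬ Conflicting c d) I

/-- A set of spheres that is invariant under integer translations. -/
def IsPeriodicFamily (I : Set (EuclideanGeometry.Sphere E3)) : Prop :=
  ∀ c ∈ I, ∀ v ∈ integerVectors, (⟨c.center + v, c.radius⟩ : EuclideanGeometry.Sphere E3) ∈ I

/-- A configuration of the parallel algorithm: the class that the outer loop is working on, the
current vertex set, and the number of parallel insertion rounds executed so far. -/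
structure Config where
  classIndex : ℕ
  points : Set E3
  rounds : ℕ

/-- The number of classes, `⌈log_β (L / s)⌉`. -/
def numClasses (β L s : ℝ) : ℕ := ⌈Real.logb β (L / s)⌉₊

/-- The transitions of parallel refinement. As long as class `i` has a candidate, the body of the
inner loop is executed: the centers of some maximal independent periodic set of candidates are
inserted at once. When class `i` has no candidate, the outer loop moves on to the next class. -/
inductive ParallelStep (β L s : ℝ) : Config → Config → Prop
  | insert (i : ℕ) (S : Set E3) (n : ℕ) (I : Set (EuclideanGeometry.Sphere E3))
      (hi : i < numClasses β L s) (hne : (candidates β s i S).Nonempty)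
      (hI : IsMaximalIndependent (candidates β s i S) I) (hper : IsPeriodicFamily I) :
      ParallelStep β L s ⟨i, S, n⟩ ⟨i, S ∪ EuclideanGeometry.Sphere.center '' I, n + 1⟩
  | advance (i : ℕ) (S : Set E3) (n : ℕ)
      (hi : i < numClasses β L s) (hemp : candidates β s i S = ∅) :
      ParallelStep β L s ⟨i, S, n⟩ ⟨i + 1, S, n⟩

/-- The outer loop has gone through all classes. -/
def Halted (β L s : ℝ) (c : Config) : Prop := numClasses β L s ≤ c.classIndex

/-- The configuration in which the algorithm starts on the vertex set `S`. -/
def start (S : Set E3) : Config := ⟨0, S, 0⟩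

end DelaunayRefinement

end

open DelaunayRefinement

/-! Refinement never creates a distance below `s₀`: the circumcenter of a bad tetrahedron has
distance more than `β * s₀` from every old vertex, and non-conflicting spheres have centers at least
the smaller radius apart. Circumradii stay at most `L`, since a ball that is empty later was already
empty in the input. As there are O(log(L/s₀)) classes, it remains to bound the rounds within one
class by O(log(L/s₀)).

Fix class `i`. A round inserts only points at distance at least `β ^ (i + 1) * s₀` from all others,
so the shortest edge pq of a bad tetrahedron of this class after t rounds was present throughout.
Its circumball was empty one round earlier, where it grows, keeping p and q on its boundary, to the
circumball of a Delaunay tetrahedron (`IsPeriodicPointSet.exists_isDelaunay`). Let R be the radius.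
That tetrahedron was bad and of class `i`, so by maximality a center d was inserted inside its
circumball; d lies within 2R of p and at least R/2 from all older points. Repeating this backwards
with the grown ball gives t such points (`TracesRounds.insert`). All R lie in `[s₀, L]`; packing
allows boundedly many points per dyadic scale of R, so t = O(log(L/s₀)) (`HasTrace.le_roundBound`).

The same growth argument shows that finished classes stay finished. Finally, sequential refinement
keeps the input points, so `s ≤ s₀` and the bound holds with `s`. -/

namespace DelaunayRefinement

/-! ### Periodic point sets and empty balls -/

/-- A non-empty, locally finite point set that is invariant under integer translations. -/
structure IsPeriodicPointSet (S : Set E3) : Prop where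
  nonempty : S.Nonempty
  add_mem : ∀ x ∈ S, ∀ v ∈ integerVectors, x + v ∈ S
  finite_inter : ∀ x r, (S ∩ Metric.closedBall x r).Finite

/-- The open ball with center `c` and radius `r` contains no point of `S`. -/
def IsEmptyBall (S : Set E3) (c : E3) (r : ℝ) : Prop := ∀ x ∈ S, r ≤ dist x c

theorem IsEmptyBall.mono {S S' : Set E3} (h : S ⊆ S') {c : E3} {r : ℝ} (hS : IsEmptyBall S' c r) :
    IsEmptyBall S c r := fun x hx => hS x (h hx)

theorem zero_mem_integerVectors : (0 : E3) ∈ integerVectors := fun k => ⟨0, by simp⟩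

theorem add_mem_integerVectors {v w : E3} (hv : v ∈ integerVectors) (hw : w ∈ integerVectors) :
    v + w ∈ integerVectors := by
  intro k
  obtain ⟨a, ha⟩ := hv k
  obtain ⟨b, hb⟩ := hw k
  exact ⟨a + b, by simp [ha, hb]⟩

theorem neg_mem_integerVectors {v : E3} (hv : v ∈ integerVectors) : -v ∈ integerVectors := by
  intro k
  obtain ⟨a, ha⟩ := hv k
  exact ⟨-a, by simp [ha]⟩

theorem sub_mem_integerVectors {v w : E3} (hv : v ∈ integerVectors) (hw : w ∈ integerVectors) :
    v - w ∈ integerVectors := by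
  rw [sub_eq_add_neg]
  exact add_mem_integerVectors hv (neg_mem_integerVectors hw)

theorem one_le_norm_of_mem_integerVectors {v : E3} (hv : v ∈ integerVectors) (h0 : v ≠ 0) :
    1 ≤ ‖v‖ := by
  have : ∃ k, v k ≠ 0 := by
    by_contra! h
    exact h0 (by ext k; simpa using h k)
  obtain ⟨k, hk⟩ := this
  obtain ⟨n, hn⟩ := hv k
  have hn0 : n ≠ 0 := by rintro rfl; simp at hn; exact hk hn
  have h1 : (1 : ℝ) ≤ |v k| := by
    rw [hn, ← Int.cast_abs]; exact_mod_cast Int.one_le_abs hn0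
  exact h1.trans (by simpa using PiLp.norm_apply_le v k)

theorem exists_integerVector_near (x : E3) : ∃ v ∈ integerVectors, ‖x - v‖ < 1 := by
  refine ⟨WithLp.toLp 2 fun k => (round (x k) : ℝ), fun k => ⟨round (x k), rfl⟩, ?_⟩
  rw [EuclideanSpace.norm_eq, Real.sqrt_lt' one_pos]
  have h : ∀ k : Fin 3, ‖(x - WithLp.toLp 2 fun k => (round (x k) : ℝ)) k‖ ^ 2 ≤ 1 / 4 := by
    intro k
    have := abs_sub_round (x k)
    simp only [PiLp.sub_apply, Real.norm_eq_abs]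
    nlinarith [abs_nonneg (x k - round (x k))]
  rw [Fin.sum_univ_three]
  linarith [h 0, h 1, h 2]

theorem IsPeriodicPointSet.exists_dist_lt {S : Set E3} (hS : IsPeriodicPointSet S) (c : E3) :
    ∃ x ∈ S, dist x c < 1 := by
  obtain ⟨y, hy⟩ := hS.nonempty
  obtain ⟨v, hv, h⟩ := exists_integerVector_near (c - y)
  refine ⟨y + v, hS.add_mem y hy v hv, ?_⟩
  rw [dist_comm, dist_eq_norm]
  rwa [← sub_sub]

theorem IsPeriodicPointSet.lt_one_of_isEmptyBall {S : Set E3} (hS : IsPeriodicPointSet S) {c : E3}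
    {r : ℝ} (h : IsEmptyBall S c r) : r < 1 := by
  obtain ⟨x, hx, hd⟩ := hS.exists_dist_lt c
  exact (h x hx).trans_lt hd

theorem IsDelaunay.isEmptyBall {S : Set E3} {T : Tetrahedron} (hT : IsDelaunay S T) :
    IsEmptyBall S T.circumcenter T.circumradius := hT.2

/-! ### Growing empty balls to Delaunay balls -/

/-- A tetrahedron with prescribed vertices `p`, `q` and the other vertices in a spanning set. -/
theorem exists_tetrahedron_of_affineSpan_eq_top {A : Set E3} (hA : affineSpan ℝ A = ⊤) {p q : E3}
    (hp : p ∈ A) (hq : q ∈ A) :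
    ∃ T : Tetrahedron, (∀ i, T.points i ∈ A) ∧ p ∈ Set.range T.points ∧ q ∈ Set.range T.points := by
  -- Removing `p` makes this set empty when `q = p`, so one basis extension serves both cases.
  have hs : LinearIndepOn ℝ (fun x : E3 => x - p) ({q} \ {p} : Set E3) := by
    by_cases h : q = p
    · simp [h]
    · have : ({q} \ {p} : Set E3) = {q} := by simpa using h
      rw [this]
      exact LinearIndepOn.singleton (sub_ne_zero.2 h)
  obtain ⟨b, hbA, hqb, hspan, hb⟩ := exists_linearIndepOn_extension hs
    (show ({q} \ {p} : Set E3) ⊆ A from fun x hx => by rw [hx.1]; exact hq)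
  have htop : Submodule.span ℝ ((fun x : E3 => x - p) '' A) = ⊤ := by
    have h1 := vectorSpan_eq_span_vsub_set_right ℝ hp
    simp only [vsub_eq_sub] at h1
    rw [← h1, ← direction_affineSpan, hA, AffineSubspace.direction_top]
  have hbtop : ⊤ ≤ Submodule.span ℝ (Set.range fun x : b => (x : E3) - p) := by
    rw [← htop, Submodule.span_le, ← Set.image_eq_range (fun x : E3 => x - p) b]
    exact hspan
  let B : Module.Basis b ℝ E3 := Module.Basis.mk hb hbtop
  have hfr : Module.finrank ℝ E3 = 3 := by simp
  let e : b ≃ Fin 3 := B.indexEquiv (Module.finBasisOfFinrankEq ℝ E3 hfr)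
  let f : Fin 4 → E3 := Fin.cons p fun i => (e.symm i : E3)
  have hf : AffineIndependent ℝ f := by
    rw [affineIndependent_iff_linearIndependent_vsub ℝ f 0]
    rw [← linearIndependent_equiv (finSuccAboveEquiv (0 : Fin 4))]
    have h2 := LinearIndependent.comp hb e.symm e.symm.injective
    exact h2
  refine ⟨⟨f, hf⟩, ?_, ⟨0, rfl⟩, ?_⟩
  · intro i
    refine Fin.cases hp (fun j => ?_) i
    exact hbA (e.symm j).2
  · by_cases h : q = p
    · exact ⟨0, by simp [f, h]⟩
    · exact ⟨(e ⟨q, hqb ⟨rfl, h⟩⟩).succ, by simp [f]⟩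

/-- The circumscribed sphere of a tetrahedron inscribed in a sphere. -/
theorem circumcenter_eq_of_dist_eq {T : Tetrahedron} {c : E3} {r : ℝ}
    (h : ∀ i, dist (T.points i) c = r) : T.circumcenter = c ∧ T.circumradius = r := by
  have htop : affineSpan ℝ (Set.range T.points) = ⊤ :=
    T.independent.affineSpan_eq_top_iff_card_eq_finrank_add_one.2 (by simp)
  have hc : c ∈ affineSpan ℝ (Set.range T.points) := by rw [htop]; trivial
  exact ⟨(T.eq_circumcenter_of_dist_eq hc h).symm, (T.eq_circumradius_of_dist_eq hc h).symm⟩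

/-- A center that is a farthest one from `p` among the centers of the empty balls through `p`
and `q` is the circumcenter of points spanning the space. -/
theorem affineSpan_eq_top_of_isMaxOn {S : Set E3}
    (hfin : ∀ x r, (S ∩ Metric.closedBall x r).Finite) {p q : E3} (hp : p ∈ S) (hq : q ∈ S) {v : E3}
    (hvq : dist q v = dist p v) (hv : IsEmptyBall S v (dist p v))
    (hmax : ∀ w, dist q w = dist p w → IsEmptyBall S w (dist p w) → dist p w ≤ dist p v) :
    affineSpan ℝ {x | x ∈ S ∧ dist x v = dist p v} = ⊤ := by
  set A : Set E3 := {x | x ∈ S ∧ dist x v = dist p v} with hAdef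
  have hpA : p ∈ A := ⟨hp, rfl⟩
  have hqA : q ∈ A := ⟨hq, hvq⟩
  by_contra hne
  have hdir : (affineSpan ℝ A).direction ≠ ⊤ := fun h =>
    hne ((AffineSubspace.direction_eq_top_iff_of_nonempty ⟨p, mem_affineSpan ℝ hpA⟩).1 h)
  have hperp : (affineSpan ℝ A).directionᗮ ≠ ⊥ := fun h => hdir (Submodule.orthogonal_eq_bot_iff.1 h)
  obtain ⟨w₀, hw₀, hw₀0⟩ := Submodule.exists_mem_ne_zero_of_ne_bot hperp
  -- With this sign, moving the center from `v` along `w` increases the radius, while `w` being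
  -- orthogonal to the span keeps all of `A` on the sphere.
  obtain ⟨w, hw, hw0, hsign⟩ : ∃ w ∈ (affineSpan ℝ A).directionᗮ, w ≠ 0 ∧
      inner ℝ (p - v) w ≤ 0 := by
    rcases le_total (inner ℝ (p - v) w₀) 0 with h | h
    · exact ⟨w₀, hw₀, hw₀0, h⟩
    · exact ⟨-w₀, Submodule.neg_mem _ hw₀, neg_ne_zero.2 hw₀0, by rw [inner_neg_right]; linarith⟩
  have horth : ∀ x ∈ A, inner ℝ (x - v) w = inner ℝ (p - v) w := by
    intro x hx
    have h1 : x - p ∈ (affineSpan ℝ A).direction :=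
      AffineSubspace.vsub_mem_direction (mem_affineSpan ℝ hx) (mem_affineSpan ℝ hpA)
    have h2 := Submodule.inner_right_of_mem_orthogonal h1 hw
    have : x - v = (x - p) + (p - v) := by abel
    rw [this, inner_add_left, h2, zero_add]
  have hsq : ∀ x ∈ A, ∀ t : ℝ, dist x (v + t • w) ^ 2 =
      dist p v ^ 2 - 2 * (t * inner ℝ (p - v) w) + t ^ 2 * ‖w‖ ^ 2 := by
    intro x hx t
    rw [dist_eq_norm, ← sub_sub, norm_sub_sq_real, inner_smul_right, horth x hx, norm_smul,
      ← dist_eq_norm, hx.2, mul_pow, Real.norm_eq_abs, sq_abs]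
  have heq : ∀ x ∈ A, ∀ t : ℝ, dist x (v + t • w) = dist p (v + t • w) := fun x hx t =>
    (sq_eq_sq₀ dist_nonneg dist_nonneg).1 (by rw [hsq x hx, hsq p hpA])
  have hcont : Continuous fun t : ℝ => v + t • w := by fun_prop
  -- Local finiteness: only finitely many points off the sphere are near it, and each stays outside
  -- for small `t`. Points beyond `dist p v + 1` are handled by a shift of less than 1/2.
  have hnear : ∀ᶠ t : ℝ in nhds 0, ∀ x ∈ (S ∩ Metric.closedBall v (dist p v + 1)) \ A,
      dist p (v + t • w) < dist x (v + t • w) := by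
    rw [Filter.eventually_all_finite ((hfin v (dist p v + 1)).subset Set.sdiff_subset)]
    rintro x ⟨⟨hxS, -⟩, hxA⟩
    refine (continuous_const.dist hcont).continuousAt.eventually_lt
      (continuous_const.dist hcont).continuousAt ?_
    simp only [zero_smul, add_zero]
    exact lt_of_le_of_ne (hv x hxS) fun h => hxA ⟨hxS, h.symm⟩
  have hsmall : ∀ᶠ t : ℝ in nhds 0, dist (v + t • w) v < 1 / 2 := by
    have := (hcont.dist (continuous_const (y := v))).tendsto 0
    refine this.eventually_lt_const ?_
    simp
  obtain ⟨t, ⟨hn, hsm⟩, ht⟩ := ((hnear.and hsmall).filter_mono nhdsWithin_le_nhds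
    |>.and (self_mem_nhdsWithin : Set.Ioi (0 : ℝ) ∈ nhdsWithin 0 (Set.Ioi 0))).exists
  have ht0 : (0 : ℝ) < t := ht
  have hle := hmax (v + t • w) (heq q hqA t) fun x hx => by
    by_cases hxA : x ∈ A
    · exact (heq x hxA t).ge
    by_cases hxb : dist x v ≤ dist p v + 1
    · exact (hn x ⟨⟨hx, hxb⟩, hxA⟩).le
    · have h1 := dist_triangle p v (v + t • w)
      have h2 := dist_triangle x (v + t • w) v
      rw [dist_comm v] at h1
      linarith
  have h3 := hsq p hpA t
  have h4 : 0 < t ^ 2 * ‖w‖ ^ 2 := by have := norm_pos_iff.2 hw0; positivity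
  have h5 : t * inner ℝ (p - v) w ≤ 0 := mul_nonpos_of_nonneg_of_nonpos ht0.le hsign
  have h6 := pow_le_pow_left₀ dist_nonneg hle 2
  linarith

/-- An empty ball with `p` and `q` on its boundary grows to the circumscribed ball of a Delaunay
tetrahedron with vertices `p` and `q`. -/
theorem IsPeriodicPointSet.exists_isDelaunay {S : Set E3} (hS : IsPeriodicPointSet S) {p q c : E3}
    (hp : p ∈ S) (hq : q ∈ S) (hpq : dist q c = dist p c) (hc : IsEmptyBall S c (dist p c)) :
    ∃ T, IsDelaunay S T ∧ p ∈ Set.range T.points ∧ q ∈ Set.range T.points ∧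
      dist p c ≤ T.circumradius := by
  let F : Set E3 := {w | dist q w = dist p w ∧ IsEmptyBall S w (dist p w)}
  have hFclosed : IsClosed F := by
    refine (isClosed_eq (by fun_prop) (by fun_prop)).inter ?_
    have : {w | IsEmptyBall S w (dist p w)} = ⋂ x ∈ S, {w | dist p w ≤ dist x w} := by
      ext w
      simp [IsEmptyBall]
    change IsClosed {w | IsEmptyBall S w (dist p w)}
    rw [this]
    exact isClosed_biInter fun x _ => isClosed_le (by fun_prop) (by fun_prop)
  have hFcomp : IsCompact F := by
    refine Metric.isCompact_of_isClosed_isBounded hFclosed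
      ((Metric.isBounded_closedBall (x := p) (r := 1)).subset fun w hw => ?_)
    rw [Metric.mem_closedBall, dist_comm]
    exact (hS.lt_one_of_isEmptyBall hw.2).le
  obtain ⟨v, hvF, hvmax⟩ := hFcomp.exists_isMaxOn ⟨c, hpq, hc⟩
    (f := fun w => dist p w) (by fun_prop)
  have hmax : ∀ w ∈ F, dist p w ≤ dist p v := fun w hw => hvmax hw
  have htop := affineSpan_eq_top_of_isMaxOn hS.finite_inter hp hq hvF.1 hvF.2
    fun w h1 h2 => hmax w ⟨h1, h2⟩
  obtain ⟨T, hTA, hTp, hTq⟩ := exists_tetrahedron_of_affineSpan_eq_top htop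
    (p := p) (q := q) ⟨hp, rfl⟩ ⟨hq, hvF.1⟩
  obtain ⟨h1, h2⟩ := circumcenter_eq_of_dist_eq fun i => (hTA i).2
  refine ⟨T, ⟨fun i => (hTA i).1, ?_⟩, hTp, hTq, ?_⟩
  · rw [h1, h2]; exact hvF.2
  · rw [h2]; exact hmax c ⟨hpq, hc⟩

/-- Every empty ball is at most as large as the circumscribed ball of some Delaunay tetrahedron. -/
theorem IsPeriodicPointSet.exists_isDelaunay_le_circumradius {S : Set E3}
    (hS : IsPeriodicPointSet S) {c : E3} {r : ℝ} (hc : IsEmptyBall S c r) :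
    ∃ T, IsDelaunay S T ∧ r ≤ T.circumradius := by
  obtain ⟨x, hx, hx1⟩ := hS.exists_dist_lt c
  obtain ⟨p, hp, hmin⟩ := Set.exists_min_image _ (fun y => dist y c) (hS.finite_inter c 1)
    ⟨x, hx, hx1.le⟩
  -- The ball is first enlarged to the nearest point `p`; then `q = p` makes equidistance vacuous.
  obtain ⟨T, hT, -, -, hr⟩ := hS.exists_isDelaunay (c := c) hp.1 hp.1 rfl fun y hy => by
    rcases le_total (dist y c) 1 with h | h
    · exact hmin y ⟨hy, h⟩
    · exact (Metric.mem_closedBall.1 hp.2).trans h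
  exact ⟨T, hT, (hc p hp.1).trans hr⟩

/-! ### Shortest edges and the minimum distance -/

theorem exists_shortestEdge_eq (T : Tetrahedron) :
    ∃ i j, i ≠ j ∧ shortestEdge T = dist (T.points i) (T.points j) := by
  have hfin : (edgeLengths T).Finite :=
    (Set.finite_range fun x : Fin 4 × Fin 4 => dist (T.points x.1) (T.points x.2)).subset
      (by rintro l ⟨i, j, -, rfl⟩; exact ⟨(i, j), rfl⟩)
  have hne : (edgeLengths T).Nonempty := ⟨_, 0, 1, by decide, rfl⟩
  exact hne.csInf_mem hfin

theorem shortestEdge_le {T : Tetrahedron} {l : ℝ} (h : l ∈ edgeLengths T) : shortestEdge T ≤ l :=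
  csInf_le ⟨0, by rintro l ⟨i, j, -, rfl⟩; exact dist_nonneg⟩ h

theorem dist_mem_edgeLengths {T : Tetrahedron} {p q : E3} (hp : p ∈ Set.range T.points)
    (hq : q ∈ Set.range T.points) (hpq : p ≠ q) : dist p q ∈ edgeLengths T := by
  obtain ⟨i, rfl⟩ := hp
  obtain ⟨j, rfl⟩ := hq
  exact ⟨i, j, fun h => hpq (by rw [h]), rfl⟩

theorem shortestEdge_pos (T : Tetrahedron) : 0 < shortestEdge T := by
  obtain ⟨i, j, hij, h⟩ := exists_shortestEdge_eq T
  rw [h]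
  exact dist_pos.2 fun h => hij (T.independent.injective h)

theorem isBad_iff {β : ℝ} {T : Tetrahedron} :
    IsBad β T ↔ β * shortestEdge T < T.circumradius := lt_div_iff₀ (shortestEdge_pos T)

/-- Translation brings the first point of any pair into the unit ball, so only finitely many pairs
no longer than `dist x y` compete. -/
theorem exists_closest_pair {S : Set E3} (hS : IsPeriodicPointSet S) {x y : E3} (hx : x ∈ S)
    (hy : y ∈ S) (hxy : x ≠ y) :
    ∃ p ∈ S, ∃ q ∈ S, p ≠ q ∧ ∀ x' ∈ S, ∀ y' ∈ S, x' ≠ y' → dist p q ≤ dist x' y' := by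
  let D := dist x y
  let G : Set (E3 × E3) := {z | (z.1 ∈ S ∩ Metric.closedBall 0 1 ∧
    z.2 ∈ S ∩ Metric.closedBall 0 (1 + D)) ∧ z.1 ≠ z.2}
  have hG : G.Finite := ((hS.finite_inter 0 1).prod (hS.finite_inter 0 (1 + D))).subset
    fun z hz => hz.1
  have hmove : ∀ x' ∈ S, ∀ y' ∈ S, x' ≠ y' → dist x' y' ≤ D →
      ∃ z ∈ G, dist z.1 z.2 = dist x' y' := by
    intro x' hx' y' hy' hne hD
    obtain ⟨v, hv, hv1⟩ := exists_integerVector_near x'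
    have hv' := neg_mem_integerVectors hv
    refine ⟨(x' + -v, y' + -v), ⟨⟨⟨hS.add_mem _ hx' _ hv', ?_⟩, hS.add_mem _ hy' _ hv', ?_⟩, ?_⟩, ?_⟩
    · simpa [← sub_eq_add_neg] using hv1.le
    · rw [mem_closedBall_zero_iff]
      have : y' + -v = (x' - v) + (y' - x') := by abel
      rw [this]
      refine (norm_add_le _ _).trans (add_le_add hv1.le ?_)
      rwa [← dist_eq_norm, dist_comm]
    · simpa using hne
    · simp
  obtain ⟨z₀, hz₀, -⟩ := hmove x hx y hy hxy le_rfl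
  obtain ⟨z, hz, hmin⟩ := Set.exists_min_image G (fun z => dist z.1 z.2) hG ⟨z₀, hz₀⟩
  refine ⟨z.1, hz.1.1.1, z.2, hz.1.2.1, hz.2, fun x' hx' y' hy' hne => ?_⟩
  rcases le_total (dist x' y') D with h | h
  · obtain ⟨u, hu, hud⟩ := hmove x' hx' y' hy' hne h
    exact hud ▸ hmin u hu
  · obtain ⟨u, hu, hud⟩ := hmove x hx y hy hxy le_rfl
    exact (hmin u hu).trans (hud.le.trans h)

/-- The Delaunay mesh has an edge that is at most as long as any given distance in the point set. -/
theorem IsPeriodicPointSet.exists_meshEdgeLength_le {S : Set E3} (hS : IsPeriodicPointSet S)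
    {x y : E3} (hx : x ∈ S) (hy : y ∈ S) (hxy : x ≠ y) :
    ∃ l ∈ meshEdgeLengths S, l ≤ dist x y := by
  obtain ⟨p, hp, q, hq, hpq, hmin⟩ := exists_closest_pair hS hx hy hxy
  have h2 : dist q (midpoint ℝ p q) = dist p q / 2 := by
    rw [dist_right_midpoint]; norm_num; ring
  have h1 : dist p (midpoint ℝ p q) = dist p q / 2 := by
    rw [dist_left_midpoint]; norm_num; ring
  -- The ball with diameter `pq` is empty: a point inside it would be closer to `p` than `q` is.
  obtain ⟨T, hT, hTp, hTq, -⟩ := hS.exists_isDelaunay (c := midpoint ℝ p q) hp hq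
    (by rw [h1, h2]) fun z hz => by
      rw [h1]
      by_cases hzp : z = p
      · rw [hzp, h1]
      · have h3 := hmin z hz p hp hzp
        have h4 := dist_triangle z (midpoint ℝ p q) p
        rw [dist_comm _ p, dist_comm _ p, h1, dist_comm p z] at h4
        linarith
  exact ⟨dist p q, ⟨T, hT, dist_mem_edgeLengths hTp hTq hpq⟩, hmin x hx y hy hxy⟩

/-! ### Packing and local finiteness -/

open MeasureTheory in
/-- Volume bound for the number of `δ`-separated points in a ball of radius `m * δ`. -/
theorem card_le_of_separated {ι : Type*} (s : Finset ι) (d : ι → E3) (p : E3) {δ m : ℝ}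
    (hδ : 0 < δ) (hm : 0 ≤ m) (hs : ∀ k ∈ s, dist (d k) p ≤ m * δ)
    (hsep : ∀ k ∈ s, ∀ l ∈ s, k ≠ l → δ ≤ dist (d k) (d l)) : (s.card : ℝ) ≤ (2 * m + 1) ^ 3 := by
  have hdisj : Set.Pairwise (s : Set ι) (Function.onFun Disjoint fun k =>
      Metric.ball (d k) (δ / 2)) := by
    intro k hk l hl hkl
    exact Metric.ball_disjoint_ball (by linarith [hsep k hk l hl hkl])
  have hsub : (⋃ k ∈ s, Metric.ball (d k) (δ / 2)) ⊆ Metric.ball p ((2 * m + 1) * (δ / 2)) := by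
    refine Set.iUnion₂_subset fun k hk => Metric.ball_subset_ball' ?_
    linarith [hs k hk]
  have hvol := measure_mono (μ := (volume : Measure E3)) hsub
  rw [measure_biUnion_finset hdisj fun _ _ => measurableSet_ball] at hvol
  simp only [Measure.addHaar_ball _ _ (by positivity : 0 ≤ δ / 2),
    Measure.addHaar_ball _ p (by positivity : 0 ≤ (2 * m + 1) * (δ / 2)),
    Finset.sum_const, nsmul_eq_mul, ← mul_assoc, finrank_euclideanSpace, Fintype.card_fin] at hvol
  rw [ENNReal.mul_le_mul_iff_left (Metric.measure_ball_pos _ _ zero_lt_one).ne'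
    measure_ball_lt_top.ne] at hvol
  have h := ENNReal.toReal_le_of_le_ofReal (by positivity) hvol
  rw [ENNReal.toReal_mul, ENNReal.toReal_natCast, ENNReal.toReal_ofReal (by positivity),
    mul_pow] at h
  exact le_of_mul_le_mul_right h (by positivity)

theorem IsPeriodicPointSet.of_separated {S : Set E3} (hne : S.Nonempty)
    (hadd : ∀ x ∈ S, ∀ v ∈ integerVectors, x + v ∈ S) {δ : ℝ} (hδ : 0 < δ)
    (hsep : S.Pairwise fun x y => δ ≤ dist x y) : IsPeriodicPointSet S := by
  refine ⟨hne, hadd, fun x r => ?_⟩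
  by_contra hinf
  set m := max r 0 / δ
  have hm : 0 ≤ m := by positivity
  obtain ⟨t, ht, hcard⟩ := Set.Infinite.exists_subset_card_eq hinf (⌊(2 * m + 1) ^ 3⌋₊ + 1)
  have h := card_le_of_separated t id x hδ hm (fun k hk => by
      have h1 : dist k x ≤ r := (ht hk).2
      have h2 : m * δ = max r 0 := div_mul_cancel₀ _ hδ.ne'
      rw [h2]
      exact h1.trans (le_max_left _ _))
    fun k hk l hl hkl => hsep (ht hk).1 (ht hl).1 hkl
  rw [hcard, Nat.cast_add, Nat.cast_one] at h
  exact absurd h (Nat.lt_floor_add_one _).not_ge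

theorem isPeriodicPointSet_periodize {P : Set E3} (hfin : P.Finite) (hne : P.Nonempty) :
    IsPeriodicPointSet (periodize P) := by
  have hlat : IsPeriodicPointSet integerVectors := by
    refine .of_separated ⟨0, zero_mem_integerVectors⟩ (fun x hx v hv => add_mem_integerVectors hx hv)
      one_pos fun x hx y hy hxy => ?_
    change 1 ≤ dist x y
    rw [dist_eq_norm]
    exact one_le_norm_of_mem_integerVectors (sub_mem_integerVectors hx hy) (sub_ne_zero.2 hxy)
  refine ⟨?_, ?_, fun x r => ?_⟩
  · obtain ⟨p, hp⟩ := hne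
    exact ⟨p, p, hp, 0, zero_mem_integerVectors, by simp⟩
  · rintro _ ⟨p, hp, v, hv, rfl⟩ w hw
    exact ⟨p, hp, v + w, add_mem_integerVectors hv hw, by rw [add_assoc]⟩
  · refine (hfin.biUnion fun p _ => (hlat.finite_inter (x - p) r).image (p + ·)).subset ?_
    rintro _ ⟨⟨p, hp, v, hv, rfl⟩, hd⟩
    refine Set.mem_biUnion hp ⟨v, ⟨hv, ?_⟩, rfl⟩
    rw [Metric.mem_closedBall, dist_eq_norm] at hd ⊢
    rwa [show v - (x - p) = p + v - x by abel]

/-! ### Inserting independent families of spheres -/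

theorem Conflicting.symm {c d : EuclideanGeometry.Sphere E3} (h : Conflicting c d) :
    Conflicting d c := by
  unfold Conflicting at h ⊢
  rw [dist_comm]
  exact h.symm

instance : Std.Symm fun c d : EuclideanGeometry.Sphere E3 => ¬ Conflicting c d :=
  ⟨fun _ _ h h' => h h'.symm⟩

/-- The integer translates of a sphere. -/
def orbit (c : EuclideanGeometry.Sphere E3) : Set (EuclideanGeometry.Sphere E3) :=
  {d | ∃ v ∈ integerVectors, d = ⟨c.center + v, c.radius⟩}

theorem mem_orbit_self (c : EuclideanGeometry.Sphere E3) : c ∈ orbit c :=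
  ⟨0, zero_mem_integerVectors, by simp⟩

theorem isPeriodicFamily_orbit (c : EuclideanGeometry.Sphere E3) : IsPeriodicFamily (orbit c) := by
  rintro _ ⟨v, hv, rfl⟩ w hw
  exact ⟨v + w, add_mem_integerVectors hv hw, by simp [add_assoc]⟩

theorem orbit_pairwise {c : EuclideanGeometry.Sphere E3} (hc : c.radius ≤ 1) :
    (orbit c).Pairwise fun c d => ¬ Conflicting c d := by
  rintro _ ⟨v, hv, rfl⟩ _ ⟨w, hw, rfl⟩ hne ⟨h, -⟩
  have hvw : v - w ≠ 0 := fun h => hne (by rw [sub_eq_zero.1 h])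
  have h1 := one_le_norm_of_mem_integerVectors (sub_mem_integerVectors hv hw) hvw
  rw [dist_add_left, dist_eq_norm] at h
  change ‖v - w‖ < c.radius at h
  linarith

theorem center_image_orbit (c : EuclideanGeometry.Sphere E3) :
    EuclideanGeometry.Sphere.center '' orbit c = periodize {c.center} := by
  ext x
  constructor
  · rintro ⟨_, ⟨v, hv, rfl⟩, rfl⟩
    exact ⟨c.center, rfl, v, hv, rfl⟩
  · rintro ⟨_, rfl, v, hv, rfl⟩
    exact ⟨_, ⟨v, hv, rfl⟩, rfl⟩

theorem IsEmptyBall.add {S : Set E3} (hS : IsPeriodicPointSet S) {c v : E3} {r : ℝ}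
    (hc : IsEmptyBall S c r) (hv : v ∈ integerVectors) : IsEmptyBall S (c + v) r := by
  intro x hx
  have h := hc _ (hS.add_mem x hx _ (neg_mem_integerVectors hv))
  rwa [dist_eq_norm, show x + -v - c = x - (c + v) by abel, ← dist_eq_norm] at h

/-- Periodic pairwise independent families of spheres of radius at least `δ` whose interiors contain
no point of `S`. -/
structure IsInsertable (S : Set E3) (δ : ℝ) (I : Set (EuclideanGeometry.Sphere E3)) : Prop where
  periodic : IsPeriodicFamily I
  independent : I.Pairwise fun c d => ¬ Conflicting c d
  isEmptyBall : ∀ c ∈ I, IsEmptyBall S c.center c.radius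
  le_radius : ∀ c ∈ I, δ ≤ c.radius

theorem IsInsertable.mono {S : Set E3} {δ δ' : ℝ} {I : Set (EuclideanGeometry.Sphere E3)}
    (h : IsInsertable S δ I) (hδ : δ' ≤ δ) : IsInsertable S δ' I :=
  ⟨h.periodic, h.independent, h.isEmptyBall, fun c hc => hδ.trans (h.le_radius c hc)⟩

/-- Old points avoid the interior of each new sphere, and non-conflicting spheres have centers at
least the smaller radius apart. -/
theorem IsInsertable.le_dist {S : Set E3} {δ : ℝ} {I : Set (EuclideanGeometry.Sphere E3)}
    (h : IsInsertable S δ I) {x y : E3} (hx : x ∈ S ∪ EuclideanGeometry.Sphere.center '' I)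
    (hy : y ∈ EuclideanGeometry.Sphere.center '' I) (hxy : x ≠ y) : δ ≤ dist x y := by
  obtain ⟨d, hd, rfl⟩ := hy
  rcases hx with hx | ⟨c, hc, rfl⟩
  · exact (h.le_radius d hd).trans (h.isEmptyBall d hd x hx)
  · have hcd := h.independent hc hd fun h => hxy (by rw [h])
    by_contra! hlt
    exact hcd ⟨hlt.trans_le (h.le_radius c hc), hlt.trans_le (h.le_radius d hd)⟩

/-- This is why short edges present after a round were already there before it. -/
theorem IsInsertable.mem_of_dist_lt {S : Set E3} {δ : ℝ} {I : Set (EuclideanGeometry.Sphere E3)}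
    (h : IsInsertable S δ I) {x y : E3} (hx : x ∈ S ∪ EuclideanGeometry.Sphere.center '' I)
    (hy : y ∈ S ∪ EuclideanGeometry.Sphere.center '' I) (hxy : x ≠ y) (hd : dist x y < δ) :
    x ∈ S ∧ y ∈ S := by
  constructor
  · refine hx.resolve_right fun hx' => absurd (h.le_dist hy hx' hxy.symm) ?_
    rw [dist_comm]
    exact hd.not_ge
  · exact hy.resolve_right fun hy' => absurd (h.le_dist hx hy' hxy) hd.not_ge

/-- A periodic point set of minimum distance at least `δ`. -/
structure IsSeparatedPointSet (δ : ℝ) (S : Set E3) : Prop extends IsPeriodicPointSet S where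
  separated : S.Pairwise fun x y => δ ≤ dist x y

theorem IsSeparatedPointSet.union {S : Set E3} {δ : ℝ} (hδ : 0 < δ)
    {I : Set (EuclideanGeometry.Sphere E3)} (hS : IsSeparatedPointSet δ S)
    (hI : IsInsertable S δ I) :
    IsSeparatedPointSet δ (S ∪ EuclideanGeometry.Sphere.center '' I) := by
  have hsep : (S ∪ EuclideanGeometry.Sphere.center '' I).Pairwise fun x y => δ ≤ dist x y := by
    intro x hx y hy hxy
    by_contra! hlt
    obtain ⟨hx', hy'⟩ := hI.mem_of_dist_lt hx hy hxy hlt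
    exact hlt.not_ge (hS.separated hx' hy' hxy)
  refine ⟨.of_separated (hS.nonempty.mono Set.subset_union_left) ?_ hδ hsep, hsep⟩
  rintro x (hx | ⟨c, hc, rfl⟩) v hv
  · exact .inl (hS.add_mem x hx v hv)
  · exact .inr ⟨_, hI.periodic c hc v hv, rfl⟩

theorem IsDelaunay.le_shortestEdge {S : Set E3} {δ : ℝ} (hS : IsSeparatedPointSet δ S)
    {T : Tetrahedron} (hT : IsDelaunay S T) : δ ≤ shortestEdge T := by
  obtain ⟨i, j, hij, h⟩ := exists_shortestEdge_eq T
  rw [h]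
  exact hS.separated (hT.1 i) (hT.1 j) fun h => hij (T.independent.injective h)

/-! ### Sequential refinement keeps the minimum distance -/

/-- A sequential step inserts one orbit of spheres. The orbit is independent because empty balls
have radius below 1, while distinct integer translates are at least 1 apart. -/
theorem SequentialStep.isSeparatedPointSet {β δ : ℝ} (hβ : 1 < β) (hδ : 0 < δ) {S M : Set E3}
    (hS : IsSeparatedPointSet δ S) (h : SequentialStep β S M) : IsSeparatedPointSet δ M := by
  obtain ⟨T, hT, hbad⟩ := h
  rw [isBad_iff] at hbad
  have h1 := hT.le_shortestEdge hS
  have h2 := hS.lt_one_of_isEmptyBall hT.isEmptyBall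
  have h3 := center_image_orbit T.circumsphere
  rw [show T.circumsphere.center = T.circumcenter from rfl] at h3
  rw [← h3]
  refine hS.union hδ ⟨isPeriodicFamily_orbit _, orbit_pairwise h2.le, ?_, ?_⟩
  · rintro _ ⟨v, hv, rfl⟩
    exact hT.isEmptyBall.add hS.toIsPeriodicPointSet hv
  · rintro _ ⟨v, hv, rfl⟩
    change δ ≤ T.circumradius
    nlinarith [shortestEdge_pos T]

theorem isSeparatedPointSet_of_reflTransGen {β δ : ℝ} (hβ : 1 < β) (hδ : 0 < δ) {S M : Set E3}
    (hS : IsSeparatedPointSet δ S) (h : Relation.ReflTransGen (SequentialStep β) S M) :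
    IsSeparatedPointSet δ M ∧ S ⊆ M := by
  induction h with
  | refl => exact ⟨hS, subset_rfl⟩
  | tail _ hstep ih =>
    refine ⟨hstep.isSeparatedPointSet hβ hδ ih.1, ih.2.trans ?_⟩
    obtain ⟨T, hT, hbad⟩ := hstep
    exact Set.subset_union_left

theorem IsPeriodicPointSet.isSeparatedPointSet {S : Set E3} (hS : IsPeriodicPointSet S) {s₀ : ℝ}
    (hs₀ : IsLeast (meshEdgeLengths S) s₀) : IsSeparatedPointSet s₀ S := by
  refine ⟨hS, fun x hx y hy hxy => ?_⟩
  obtain ⟨l, hl, hle⟩ := hS.exists_meshEdgeLength_le hx hy hxy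
  exact (hs₀.2 hl).trans hle

theorem exists_dist_eq_of_mem_meshEdgeLengths {S : Set E3} {l : ℝ} (h : l ∈ meshEdgeLengths S) :
    ∃ p ∈ S, ∃ q ∈ S, p ≠ q ∧ l = dist p q := by
  obtain ⟨T, hT, i, j, hij, rfl⟩ := h
  exact ⟨_, hT.1 i, _, hT.1 j, fun h => hij (T.independent.injective h), rfl⟩

theorem pos_of_mem_meshEdgeLengths {S : Set E3} {l : ℝ} (h : l ∈ meshEdgeLengths S) : 0 < l := by
  obtain ⟨p, -, q, -, hpq, rfl⟩ := exists_dist_eq_of_mem_meshEdgeLengths h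
  exact dist_pos.2 hpq

/-- A sequentially generated mesh has an edge at most as long as the shortest initial one. -/
theorem SequentiallyGenerates.shortest_le {β : ℝ} (hβ : 1 < β) {S M : Set E3}
    (hS : IsPeriodicPointSet S) {s₀ s : ℝ} (hs₀ : IsLeast (meshEdgeLengths S) s₀)
    (hM : SequentiallyGenerates β S M) (hs : IsLeast (meshEdgeLengths M) s) : s ≤ s₀ := by
  obtain ⟨hsep, hsub⟩ := isSeparatedPointSet_of_reflTransGen hβ
    (pos_of_mem_meshEdgeLengths hs₀.1) (hS.isSeparatedPointSet hs₀) hM.1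
  obtain ⟨p, hp, q, hq, hpq, h⟩ := exists_dist_eq_of_mem_meshEdgeLengths hs₀.1
  obtain ⟨l, hl, hle⟩ := hsep.exists_meshEdgeLength_le (hsub hp) (hsub hq) hpq
  exact (hs.2 hl).trans (h ▸ hle)

/-! ### Candidates and maximal independent families -/

theorem IsDelaunay.exists_translate {S : Set E3} (hS : IsPeriodicPointSet S) {T : Tetrahedron}
    (hT : IsDelaunay S T) {v : E3} (hv : v ∈ integerVectors) :
    ∃ T', IsDelaunay S T' ∧ T'.circumcenter = T.circumcenter + v ∧
      T'.circumradius = T.circumradius ∧ shortestEdge T' = shortestEdge T := by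
  let f := (AffineIsometryEquiv.constVAdd ℝ E3 v).toAffineIsometry
  let T' : Tetrahedron := T.map f.toAffineMap f.injective
  have hpt : ∀ i, T'.points i = T.points i + v := fun i => add_comm v (T.points i)
  have hc : T'.circumcenter = T.circumcenter + v :=
    (T.circumcenter_map f).trans (add_comm v T.circumcenter)
  have hr : T'.circumradius = T.circumradius := T.circumradius_map f
  refine ⟨T', ⟨fun i => ?_, ?_⟩, hc, hr, ?_⟩
  · rw [hpt]
    exact hS.add_mem _ (hT.1 i) v hv
  · rw [hc, hr]
    exact hT.isEmptyBall.add hS hv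
  · simp [shortestEdge, edgeLengths, hpt]

theorem isPeriodicFamily_candidates {S : Set E3} (hS : IsPeriodicPointSet S) (β s : ℝ) (i : ℕ) :
    IsPeriodicFamily (candidates β s i S) := by
  rintro _ ⟨T, hT, hbad, hcl, rfl⟩ v hv
  obtain ⟨T', hT', hc, hr, he⟩ := hT.exists_translate hS hv
  refine ⟨T', hT', ?_, he ▸ hcl, ?_⟩
  · rw [isBad_iff] at hbad ⊢
    rwa [hr, he]
  · exact EuclideanGeometry.Sphere.ext hc.symm hr.symm

theorem isEmptyBall_of_mem_candidates {S : Set E3} {β s : ℝ} {i : ℕ}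
    {c : EuclideanGeometry.Sphere E3} (hc : c ∈ candidates β s i S) :
    IsEmptyBall S c.center c.radius := by
  obtain ⟨T, hT, -, -, rfl⟩ := hc
  exact hT.isEmptyBall

theorem lt_radius_of_mem_candidates {S : Set E3} {β s : ℝ} (hβ : 1 < β) {i : ℕ}
    {c : EuclideanGeometry.Sphere E3} (hc : c ∈ candidates β s i S) :
    β ^ (i + 1) * s < c.radius := by
  obtain ⟨T, hT, hbad, hcl, rfl⟩ := hc
  rw [isBad_iff] at hbad
  have h := mul_le_mul_of_nonneg_left hcl.1 (zero_le_one.trans hβ.le)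
  rw [← mul_assoc, ← pow_succ'] at h
  exact h.trans_lt hbad

/-- Candidates have periodic maximal independent subsets. -/
theorem exists_isMaximalIndependent {S : Set E3} (hS : IsPeriodicPointSet S) (β s : ℝ) (i : ℕ) :
    ∃ I, IsMaximalIndependent (candidates β s i S) I ∧ IsPeriodicFamily I := by
  set C := candidates β s i S
  have hC := isPeriodicFamily_candidates hS β s i
  -- Zorn is applied to periodic families only. The result is maximal among all families: if `c`
  -- could be added, so could its whole orbit, since a conflict of `d` with a translate of `c`
  -- translates back to a conflict with `c`.
  obtain ⟨I, hI⟩ := zorn_subset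
    {J | (J ⊆ C ∧ J.Pairwise fun c d => ¬ Conflicting c d) ∧ IsPeriodicFamily J} fun Z hZ hch => by
      refine ⟨⋃₀ Z, ⟨⟨Set.sUnion_subset fun J hJ => (hZ hJ).1.1,
        (Set.pairwise_sUnion hch.directedOn).2 fun J hJ => (hZ hJ).1.2⟩, ?_⟩,
        fun J hJ => Set.subset_sUnion_of_mem hJ⟩
      rintro c ⟨J, hJ, hcJ⟩ v hv
      exact ⟨J, hJ, (hZ hJ).2 c hcJ v hv⟩
  refine ⟨I, ⟨hI.prop.1, fun J hJ hIJ c hcJ => ?_⟩, hI.prop.2⟩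
  have hcC := hJ.1 hcJ
  have hr : c.radius ≤ 1 := (hS.lt_one_of_isEmptyBall (isEmptyBall_of_mem_candidates hcC)).le
  have hcI : ∀ d ∈ I, d ≠ c → ¬ Conflicting d c := fun d hd hne => hJ.2 (hIJ hd) hcJ hne
  by_contra hc
  refine hc (hI.le_of_ge (y := I ∪ orbit c) ⟨⟨?_, ?_⟩, ?_⟩ Set.subset_union_left
    (.inr (mem_orbit_self c)))
  · rintro d (hd | ⟨v, hv, rfl⟩)
    · exact hI.prop.1.1 hd
    · exact hC c hcC v hv
  · rw [Set.pairwise_union_of_symm]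
    refine ⟨hI.prop.1.2, orbit_pairwise hr, ?_⟩
    rintro d hd _ ⟨v, hv, rfl⟩ - hconf
    have hd' := hI.prop.2 d hd (-v) (neg_mem_integerVectors hv)
    refine hcI _ hd' (fun h => hc (h ▸ hd')) ?_
    unfold Conflicting at hconf ⊢
    have : dist (d.center + -v) c.center = dist d.center (c.center + v) := by
      rw [dist_eq_norm, dist_eq_norm]
      congr 1
      abel
    simp only [this]
    exact hconf
  · rintro d (hd | hd) v hv
    · exact .inl (hI.prop.2 d hd v hv)
    · exact .inr (isPeriodicFamily_orbit c d hd v hv)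

/-- The centers of a maximal independent family hit the interiors of all members. -/
theorem IsMaximalIndependent.exists_dist_lt {C I : Set (EuclideanGeometry.Sphere E3)}
    (hI : IsMaximalIndependent C I) {c : EuclideanGeometry.Sphere E3} (hc : c ∈ C)
    (hr : 0 < c.radius) :
    ∃ d ∈ I, dist c.center d.center < c.radius ∧ dist c.center d.center < d.radius := by
  by_contra! h
  have hnot : ∀ d ∈ I, ¬ Conflicting c d := fun d hd hcd => (h d hd hcd.1).not_gt hcd.2
  have hcI : c ∈ I := Maximal.mem_of_prop_insert hI
    ⟨Set.insert_subset hc hI.prop.1, Set.pairwise_insert_of_symm.2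
      ⟨hI.prop.2, fun d hd _ => hnot d hd⟩⟩
  exact hnot c hcI ⟨by simpa using hr, by simpa using hr⟩

theorem IsMaximalIndependent.isInsertable {β s : ℝ} (hβ : 1 < β) {i : ℕ} {S : Set E3}
    {I : Set (EuclideanGeometry.Sphere E3)} (hI : IsMaximalIndependent (candidates β s i S) I)
    (hper : IsPeriodicFamily I) : IsInsertable S (β ^ (i + 1) * s) I :=
  ⟨hper, hI.prop.2, fun _ hc => isEmptyBall_of_mem_candidates (hI.prop.1 hc),
    fun _ hc => (lt_radius_of_mem_candidates hβ (hI.prop.1 hc)).le⟩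

/-! ### Traces and the bound for one class -/

/-- An empty ball through `p` and `q` that is large compared to `dist p q` grows to the
circumscribed ball of a bad Delaunay tetrahedron. -/
theorem IsPeriodicPointSet.exists_isBad {S : Set E3} (hS : IsPeriodicPointSet S) {β : ℝ}
    (hβ : 0 ≤ β) {p q v : E3} (hp : p ∈ S) (hq : q ∈ S) (hpq : p ≠ q) (hqv : dist q v = dist p v)
    (hv : IsEmptyBall S v (dist p v)) (hlt : β * dist p q < dist p v) :
    ∃ T, IsDelaunay S T ∧ IsBad β T ∧ p ∈ Set.range T.points ∧ q ∈ Set.range T.points ∧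
      dist p v ≤ T.circumradius ∧ shortestEdge T ≤ dist p q := by
  obtain ⟨T, hT, hTp, hTq, hle⟩ := hS.exists_isDelaunay hp hq hqv hv
  have hs := shortestEdge_le (dist_mem_edgeLengths hTp hTq hpq)
  exact ⟨T, hT, isBad_iff.2 (by nlinarith [mul_le_mul_of_nonneg_left hs hβ]), hTp, hTq, hle, hs⟩

/-- A shortest edge of a bad Delaunay tetrahedron, as seen from the circumcenter. -/
theorem exists_edge_of_isBad {S : Set E3} {β : ℝ} {T : Tetrahedron} (hT : IsDelaunay S T)
    (hbad : IsBad β T) :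
    ∃ p ∈ S, ∃ q ∈ S, p ≠ q ∧ dist p q = shortestEdge T ∧ dist p T.circumcenter = T.circumradius ∧
      dist q T.circumcenter = dist p T.circumcenter ∧
      IsEmptyBall S T.circumcenter (dist p T.circumcenter) ∧
      β * dist p q < dist p T.circumcenter := by
  obtain ⟨i, j, hij, h⟩ := exists_shortestEdge_eq T
  have hi := T.dist_circumcenter_eq_circumradius i
  have hj := T.dist_circumcenter_eq_circumradius j
  refine ⟨_, hT.1 i, _, hT.1 j, fun h => hij (T.independent.injective h), h.symm, hi, by rw [hi, hj],
    hi ▸ hT.isEmptyBall, ?_⟩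
  rw [hi, ← h]
  exact isBad_iff.1 hbad

/-- There are `t` points of `S` near `p` that are separated at the scales `R k`, all of which lie in
`[r, L]`. -/
def HasTrace (S : Set E3) (L : ℝ) (p : E3) (r : ℝ) (t : ℕ) : Prop :=
  ∃ (d : ℕ → E3) (R : ℕ → ℝ), ∀ k < t, d k ∈ S ∧ r ≤ R k ∧ R k ≤ L ∧ dist (d k) p ≤ 2 * R k ∧
    ∀ l < k, R k / 2 ≤ dist (d l) (d k)

theorem hasTrace_zero (S : Set E3) (L : ℝ) (p : E3) (r : ℝ) : HasTrace S L p r 0 :=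
  ⟨fun _ => 0, fun _ => 0, fun _ h => absurd h (Nat.not_lt_zero _)⟩

theorem HasTrace.extend {S S' : Set E3} {L r R : ℝ} {p d : E3} {t : ℕ} (h : HasTrace S L p R t)
    (hSS' : S ⊆ S') (hd : d ∈ S') (hr : r ≤ R) (hR : R ≤ L) (hdp : dist d p ≤ 2 * R)
    (hsep : ∀ x ∈ S, R / 2 ≤ dist x d) : HasTrace S' L p r (t + 1) := by
  obtain ⟨e, Q, h⟩ := h
  refine ⟨fun k => if k < t then e k else d, fun k => if k < t then Q k else R, fun k hk => ?_⟩
  by_cases hkt : k < t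
  · obtain ⟨h1, h2, h3, h4, h5⟩ := h k hkt
    simp only [hkt, if_true]
    refine ⟨hSS' h1, hr.trans h2, h3, h4, fun l hl => ?_⟩
    simpa only [hl.trans hkt, if_true] using h5 l hl
  · simp only [hkt, if_false]
    refine ⟨hd, hr, hR, hdp, fun l hl => ?_⟩
    have hlt : l < t := by omega
    simpa only [hlt, if_true] using hsep _ (h l hlt).1

/-- A bound for the number of rounds in one class. -/
noncomputable def roundBound (L s : ℝ) : ℕ := 4913 * (⌊Real.logb 2 (L / s)⌋₊ + 1)

/-- The points are sorted by the dyadic scale of `R k / s`; each scale is bounded by volume. -/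
theorem HasTrace.le_roundBound {S : Set E3} {L r s : ℝ} {p : E3} {t : ℕ} (h : HasTrace S L p r t)
    (hs : 0 < s) (hsr : s ≤ r) : t ≤ roundBound L s := by
  obtain ⟨d, R, h⟩ := h
  let f : ℕ → ℕ := fun k => ⌊Real.logb 2 (R k / s)⌋₊
  have hmaps : ∀ k ∈ Finset.range t, f k ∈ Finset.range (⌊Real.logb 2 (L / s)⌋₊ + 1) := by
    intro k hk
    obtain ⟨-, h2, h3, -⟩ := h k (Finset.mem_range.1 hk)
    have hRk : 0 < R k := hs.trans_le (hsr.trans h2)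
    rw [Finset.mem_range, Nat.lt_succ_iff]
    refine Nat.floor_le_floor ?_
    exact Real.logb_le_logb_of_le one_lt_two (by positivity) (by gcongr)
  have hcard := Finset.card_le_mul_card_image_of_maps_to hmaps 4913 fun j _ => by
    have hpow : (0 : ℝ) < 2 ^ j * s := by positivity
    have hscale : ∀ k ∈ {k ∈ Finset.range t | f k = j}, 2 ^ j * s ≤ R k ∧ R k < 2 * (2 ^ j * s) ∧
        k < t := by
      intro k hk
      obtain ⟨hk, hfk⟩ := Finset.mem_filter.1 hk
      have hkt := Finset.mem_range.1 hk
      obtain ⟨-, h2, -⟩ := h k hkt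
      have hRs : 1 ≤ R k / s := (one_le_div hs).2 (hsr.trans h2)
      have hlog : 0 ≤ Real.logb 2 (R k / s) := Real.logb_nonneg one_lt_two hRs
      have h3 : (j : ℝ) ≤ Real.logb 2 (R k / s) := hfk ▸ Nat.floor_le hlog
      have h4 : Real.logb 2 (R k / s) < j + 1 := hfk ▸ Nat.lt_floor_add_one _
      rw [Real.le_logb_iff_rpow_le one_lt_two (by linarith), Real.rpow_natCast, le_div_iff₀ hs] at h3
      rw [Real.logb_lt_iff_lt_rpow one_lt_two (by linarith), ← Nat.cast_add_one, Real.rpow_natCast,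
        div_lt_iff₀ hs, pow_succ'] at h4
      exact ⟨h3, by linarith, hkt⟩
    have hlt : ∀ k ∈ {k ∈ Finset.range t | f k = j}, ∀ l ∈ {k ∈ Finset.range t | f k = j}, l < k →
        2 ^ j * s / 2 ≤ dist (d l) (d k) := by
      intro k hk l hl hlk
      obtain ⟨h1, -, hkt⟩ := hscale k hk
      linarith [(h k hkt).2.2.2.2 l hlk]
    -- At scale `j` the distance to `p` is at most `2 * R k`, hence below `8 * δ`; this gives 17³ =
    -- 4913.
    have := card_le_of_separated {k ∈ Finset.range t | f k = j} d p (δ := 2 ^ j * s / 2) (m := 8)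
      (by positivity) (by norm_num) (fun k hk => by
        obtain ⟨-, h2, hkt⟩ := hscale k hk
        linarith [(h k hkt).2.2.2.1]) fun k hk l hl hkl => by
        rcases lt_or_gt_of_ne hkl with hkl | hkl
        · exact hlt l hl k hk hkl
        · rw [dist_comm]
          exact hlt k hk l hl hkl
    have h4913 : (2 * (8 : ℝ) + 1) ^ 3 = (4913 : ℕ) := by norm_num
    rw [h4913] at this
    exact_mod_cast this
  simpa [roundBound] using hcard

/-- Every empty ball with `p` and `q` on its boundary whose radius is large compared to
`dist p q < b` has left a trace in each of the last `t` rounds. -/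
def TracesRounds (β L b : ℝ) (S : Set E3) (t : ℕ) : Prop :=
  ∀ p ∈ S, ∀ q ∈ S, p ≠ q → dist p q < b → ∀ v, dist q v = dist p v → IsEmptyBall S v (dist p v) →
    β * dist p q < dist p v → HasTrace S L p (dist p v) t

/-! ### The invariant of parallel refinement -/

/-- The invariant of parallel refinement started on `S₀`. -/
structure Invariant (β L s : ℝ) (S₀ : Set E3) (c : Config) : Prop where
  isSeparatedPointSet : IsSeparatedPointSet s c.points
  subset : S₀ ⊆ c.points
  le_shortestEdge : ∀ T, IsDelaunay c.points T → IsBad β T → β ^ c.classIndex * s ≤ shortestEdge T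
  tracesRounds : ∃ t, c.rounds ≤ c.classIndex * (roundBound L s + 1) + t ∧
    t ≤ roundBound L s + 1 ∧ TracesRounds β L (β ^ (c.classIndex + 1) * s) c.points t
  classIndex_le : c.classIndex ≤ numClasses β L s
  lt_of_rounds_pos : 0 < c.rounds → β * s < L

/-- The input of parallel refinement. -/
structure IsInput (L s : ℝ) (S₀ : Set E3) : Prop extends IsPeriodicPointSet S₀ where
  circumradius_le : ∀ T, IsDelaunay S₀ T → T.circumradius ≤ L
  isLeast : IsLeast (meshEdgeLengths S₀) s

variable {β L s : ℝ} {S₀ : Set E3}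

theorem IsInput.pos (h : IsInput L s S₀) : 0 < s := pos_of_mem_meshEdgeLengths h.isLeast.1

theorem IsInput.circumradius_le_of_subset (h : IsInput L s S₀) {S : Set E3} (hS : S₀ ⊆ S)
    {T : Tetrahedron} (hT : IsDelaunay S T) : T.circumradius ≤ L := by
  obtain ⟨T', hT', hle⟩ := h.exists_isDelaunay_le_circumradius (hT.isEmptyBall.mono hS)
  exact hle.trans (h.circumradius_le T' hT')

theorem IsInput.upper_pos (h : IsInput L s S₀) : 0 < L := by
  obtain ⟨T, hT, i, j, hij, hs⟩ := h.isLeast.1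
  have h1 := dist_triangle_right (T.points i) (T.points j) T.circumcenter
  rw [T.dist_circumcenter_eq_circumradius, T.dist_circumcenter_eq_circumradius, ← hs] at h1
  linarith [h.pos, h.circumradius_le T hT]

theorem IsInput.invariant_start (h : IsInput L s S₀) :
    Invariant β L s S₀ (start S₀) where
  isSeparatedPointSet := h.isSeparatedPointSet h.isLeast
  subset := subset_rfl
  le_shortestEdge T hT _ := by
    simpa [start] using hT.le_shortestEdge (h.isSeparatedPointSet h.isLeast)
  tracesRounds := ⟨0, by simp [start], by simp, fun p _ _ _ _ _ v _ _ _ => hasTrace_zero _ _ _ _⟩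
  classIndex_le := Nat.zero_le _
  lt_of_rounds_pos h := absurd h (Nat.lt_irrefl 0)

/-- The backward step: a ball that survives the round comes from a candidate before it, and that
candidate was hit by an inserted center. -/
theorem TracesRounds.insert (h : IsInput L s S₀) (hβ : 1 < β) {S : Set E3}
    (hS : IsPeriodicPointSet S) (hS₀ : S₀ ⊆ S) {i t : ℕ}
    (hclean : ∀ T, IsDelaunay S T → IsBad β T → β ^ i * s ≤ shortestEdge T)
    (htr : TracesRounds β L (β ^ (i + 1) * s) S t) {I : Set (EuclideanGeometry.Sphere E3)}
    (hI : IsMaximalIndependent (candidates β s i S) I) (hper : IsPeriodicFamily I) :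
    TracesRounds β L (β ^ (i + 1) * s) (S ∪ EuclideanGeometry.Sphere.center '' I) (t + 1) := by
  have hβ0 : 0 ≤ β := by linarith
  intro p hp q hq hpq hd v hqv hv hlt
  have hins := hI.isInsertable hβ hper
  obtain ⟨hp', hq'⟩ := hins.mem_of_dist_lt hp hq hpq hd
  obtain ⟨T, hT, hbad, ⟨a, ha⟩, ⟨b, hb⟩, hle, hsh⟩ := hS.exists_isBad hβ0 hp' hq' hpq hqv
    (hv.mono Set.subset_union_left) hlt
  have hTp : dist p T.circumcenter = T.circumradius := ha ▸ T.dist_circumcenter_eq_circumradius a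
  have hTq : dist q T.circumcenter = T.circumradius := hb ▸ T.dist_circumcenter_eq_circumradius b
  -- The induction continues with the grown ball, so that earlier radii are at least the present
  -- one.
  have htrace := htr p hp' q hq' hpq hd T.circumcenter (by rw [hTp, hTq])
    (hTp ▸ hT.isEmptyBall) (by rw [hTp]; exact hlt.trans_le hle)
  rw [hTp] at htrace
  have hpos : 0 < T.circumradius :=
    (mul_nonneg hβ0 dist_nonneg).trans_lt (hlt.trans_le hle)
  obtain ⟨d, hdI, h1, h2⟩ := hI.exists_dist_lt (c := T.circumsphere)
    ⟨T, hT, hbad, ⟨hclean T hT hbad, hsh.trans_lt hd⟩, rfl⟩ hpos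
  change dist T.circumcenter d.center < T.circumradius at h1
  change dist T.circumcenter d.center < d.radius at h2
  refine htrace.extend Set.subset_union_left (.inr ⟨d, hdI, rfl⟩) hle
    (h.circumradius_le_of_subset hS₀ hT) ?_ fun x hx => ?_
  · have := dist_triangle_right d.center p T.circumcenter
    rw [dist_comm d.center T.circumcenter, hTp] at this
    linarith
  -- With `D` the distance of the two centers and `R` the circumradius, `dist x d.center` is at
  -- least `d.radius > D` and at least `R - D`; averaging gives `R / 2`.
  · have h3 := hins.isEmptyBall d hdI x hx
    have h4 := hT.isEmptyBall x hx
    have h5 := dist_triangle x d.center T.circumcenter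
    rw [dist_comm d.center] at h5
    linarith

/-- The circumball of a remaining candidate is itself a ball that must have left `t` traces. -/
theorem TracesRounds.le_roundBound (h : IsInput L s S₀) (hβ : 1 < β) {S : Set E3}
    (hS : IsSeparatedPointSet s S) {i t : ℕ} (htr : TracesRounds β L (β ^ (i + 1) * s) S t)
    (hne : (candidates β s i S).Nonempty) : t ≤ roundBound L s := by
  obtain ⟨_, T, hT, hbad, hcl, -⟩ := hne
  obtain ⟨p, hp, q, hq, hpq, hd, -, hqv, hv, hlt⟩ := exists_edge_of_isBad hT hbad
  refine (htr p hp q hq hpq (hd ▸ hcl.2) _ hqv hv hlt).le_roundBound h.pos ?_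
  nlinarith [hS.separated hp hq hpq, h.pos]

theorem Invariant.step (h : IsInput L s S₀) (hβ : 1 < β) {c d : Config}
    (hc : Invariant β L s S₀ c) (hstep : ParallelStep β L s c d) : Invariant β L s S₀ d := by
  have hs := h.pos
  have hβ0 : 0 < β := by linarith
  cases hstep with
  | insert i S n I hi hne hI hper =>
    obtain ⟨hsep, hsub, hclean, ⟨t, hn, -, htr⟩, -, -⟩ := hc
    have hins := hI.isInsertable hβ hper
    refine ⟨hsep.union hs (hins.mono ?_), hsub.trans Set.subset_union_left, ?_,
      ⟨t + 1, ?_, ?_, htr.insert h hβ hsep.toIsPeriodicPointSet hsub hclean hI hper⟩, hi.le, ?_⟩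
    · exact le_mul_of_one_le_left hs.le (one_le_pow₀ hβ.le)
    · intro T hT hbad
      obtain ⟨p, hp, q, hq, hpq, hd, -, hqv, hv, hlt⟩ := exists_edge_of_isBad hT hbad
      -- A new bad tetrahedron of a lower class would have an old shortest edge, and its circumball
      -- would grow to an old bad tetrahedron of a lower class.
      by_contra! hsh
      change shortestEdge T < β ^ i * s at hsh
      have hpow : β ^ i * s ≤ β ^ (i + 1) * s := by
        gcongr
        · exact hβ.le
        · omega
      obtain ⟨hp', hq'⟩ := hins.mem_of_dist_lt hp hq hpq (hd ▸ hsh.trans_le hpow)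
      obtain ⟨T', hT', hbad', -, -, -, hsh'⟩ := hsep.exists_isBad hβ0.le hp' hq' hpq hqv
        (hv.mono Set.subset_union_left) hlt
      have := hclean T' hT' hbad'
      change β ^ i * s ≤ shortestEdge T' at this
      linarith
    · change n + 1 ≤ i * _ + (t + 1)
      change n ≤ i * _ + t at hn
      omega
    -- The candidate that triggered this round bounds the number of rounds before it, hence the
    -- extra 1.
    · exact Nat.succ_le_succ (htr.le_roundBound h hβ hsep hne)
    · intro _
      obtain ⟨_, T, hT, hbad, -, -⟩ := hne
      have h1 := h.circumradius_le_of_subset hsub hT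
      have h2 := hT.le_shortestEdge hsep
      rw [isBad_iff] at hbad
      nlinarith
  | advance i S n hi hemp =>
    obtain ⟨hsep, hsub, hclean, ⟨t, hn, ht, -⟩, -, hpos⟩ := hc
    refine ⟨hsep, hsub, fun T hT hbad => ?_,
      -- The count of traced rounds restarts with each class.
      ⟨0, ?_, Nat.zero_le _, fun p _ _ _ _ _ v _ _ _ => hasTrace_zero _ _ _ _⟩, hi, hpos⟩
    · by_contra! hlt
      have : T.circumsphere ∈ candidates β s i S :=
        ⟨T, hT, hbad, ⟨hclean T hT hbad, hlt⟩, rfl⟩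
      rw [hemp] at this
      exact this
    · change n ≤ (i + 1) * _ + 0
      change n ≤ i * _ + t at hn
      rw [add_mul]
      omega

theorem IsInput.invariant (h : IsInput L s S₀) (hβ : 1 < β) {c : Config}
    (hc : Relation.ReflTransGen (ParallelStep β L s) (start S₀) c) : Invariant β L s S₀ c := by
  induction hc with
  | refl => exact h.invariant_start
  | tail _ hstep ih => exact ih.step h hβ hstep

theorem Invariant.rounds_le {c : Config} (hc : Invariant β L s S₀ c) :
    c.rounds ≤ (numClasses β L s + 1) * (roundBound L s + 1) := by
  obtain ⟨t, h1, h2, -⟩ := hc.tracesRounds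
  have := Nat.mul_le_mul_right (roundBound L s + 1) hc.classIndex_le
  rw [add_mul]
  omega

theorem Invariant.exists_step {c : Config} (hc : Invariant β L s S₀ c)
    (hh : ¬ Halted β L s c) : ∃ d, ParallelStep β L s c d := by
  obtain ⟨i, S, n⟩ := c
  have hi : i < numClasses β L s := not_le.1 hh
  rcases (candidates β s i S).eq_empty_or_nonempty with he | hne
  · exact ⟨_, .advance i S n hi he⟩
  · obtain ⟨I, hI, hper⟩ := exists_isMaximalIndependent
      hc.isSeparatedPointSet.toIsPeriodicPointSet β s i
    exact ⟨_, .insert i S n I hi hne hI hper⟩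

/-- After the last class, a bad tetrahedron would have shortest edge at least `β ^ numClasses β L s
* s ≥ L`, hence circumradius above `L`. -/
theorem Invariant.hasRadiusEdgeBound (h : IsInput L s S₀) (hβ : 1 < β) {c : Config}
    (hc : Invariant β L s S₀ c) (hh : Halted β L s c) : HasRadiusEdgeBound β c.points := by
  have hs := h.pos
  have hL := h.upper_pos
  intro T hT
  by_contra! hbad
  have h1 := hc.le_shortestEdge T hT hbad
  have h2 := h.circumradius_le_of_subset hc.subset hT
  have h3 : Real.logb β (L / s) ≤ c.classIndex :=
    (Nat.le_ceil _).trans (by exact_mod_cast hh)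
  rw [Real.logb_le_iff_le_rpow hβ (by positivity), Real.rpow_natCast, div_le_iff₀ hs] at h3
  have h4 := isBad_iff.1 hbad
  nlinarith [shortestEdge_pos T]

/-! ### Termination and the final count -/

/-- Each transition raises exactly one of the two counters by 1, so bounds on both end every run. -/
theorem classIndex_add_rounds_eq {run : ℕ → Config} (h0 : run 0 = start S₀)
    (hrun : ∀ k, ParallelStep β L s (run k) (run (k + 1))) (k : ℕ) :
    (run k).classIndex + (run k).rounds = k := by
  induction k with
  | zero => rw [h0]; rfl
  | succ k ih =>
    have hstep := hrun k
    generalize run k = c at hstep ih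
    generalize run (k + 1) = d at hstep
    cases hstep <;> simp only at ih ⊢ <;> omega

theorem IsInput.not_infinite_run (h : IsInput L s S₀) (hβ : 1 < β) {run : ℕ → Config}
    (h0 : run 0 = start S₀) : ¬ ∀ k, ParallelStep β L s (run k) (run (k + 1)) := by
  intro hrun
  have hreach : ∀ k, Relation.ReflTransGen (ParallelStep β L s) (start S₀) (run k) := by
    intro k
    induction k with
    | zero => rw [h0]
    | succ k ih => exact ih.tail (hrun k)
  set N := numClasses β L s + (numClasses β L s + 1) * (roundBound L s + 1) + 1
  have hinv := h.invariant hβ (hreach N)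
  have h1 := hinv.rounds_le
  have h2 := hinv.classIndex_le
  have h3 := classIndex_add_rounds_eq h0 hrun N
  omega

/-- From `β * s < L` one gets `1 ≤ log (L / s) / log β`, which absorbs the additive constants into
multiples of the logarithm. -/
theorem numClasses_mul_roundBound_le (hβ : 1 < β) (hs : 0 < s) (hL : β * s < L) :
    (((numClasses β L s + 1) * (roundBound L s + 1) : ℕ) : ℝ) ≤
      3 / Real.log β * (4913 * (1 / Real.log 2 + 1 / Real.log β) + 1 / Real.log β) *
        Real.log (L / s) ^ 2 := by
  set x := Real.log (L / s) with hx
  set b := Real.log β with hb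
  have hb0 : 0 < b := Real.log_pos hβ
  have h20 : 0 < Real.log 2 := Real.log_pos one_lt_two
  have hbx : b ≤ x := Real.log_le_log (by linarith) ((le_div_iff₀ hs).2 hL.le)
  have hx0 : 0 < x := hb0.trans_le hbx
  have h1 : 1 ≤ 1 / b * x := by
    rw [one_div_mul_eq_div]
    exact (one_le_div hb0).2 hbx
  have hN : (numClasses β L s : ℝ) + 1 ≤ 3 / b * x := by
    have : (numClasses β L s : ℝ) < x / b + 1 := Nat.ceil_lt_add_one (div_nonneg hx0.le hb0.le)
    have h3 : 3 / b * x = x / b + 2 * (1 / b * x) := by ring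
    linarith
  have hK : (roundBound L s : ℝ) + 1 ≤ (4913 * (1 / Real.log 2 + 1 / b) + 1 / b) * x := by
    have : (⌊Real.logb 2 (L / s)⌋₊ : ℝ) ≤ x / Real.log 2 :=
      Nat.floor_le (div_nonneg hx0.le h20.le)
    have h3 : (4913 * (1 / Real.log 2 + 1 / b) + 1 / b) * x =
        4913 * (x / Real.log 2 + 1 / b * x) + 1 / b * x := by ring
    rw [h3, roundBound]
    push_cast
    linarith
  push_cast
  calc _ ≤ (3 / b * x) * ((4913 * (1 / Real.log 2 + 1 / b) + 1 / b) * x) := by gcongr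
    _ = _ := by ring

end DelaunayRefinement

theorem mainTheorem7 (β : ℝ) (hβ : 1 < β) :
    ∃ C : ℝ, 0 < C ∧
      ∀ (P : Set E3), P.Finite → P.Nonempty → P ⊆ unitCube →
      ∀ L : ℝ, Metric.diam P ≤ L →
        (∀ T, IsDelaunay (periodize P) T → T.circumradius ≤ L) →
      -- `s₀` is the length of the shortest edge in the initial mesh; the algorithm uses it
      ∀ s₀ : ℝ, IsLeast (meshEdgeLengths (periodize P)) s₀ →
      -- `s` is the length of the shortest edge in a mesh generated by sequential refinement
      ∀ (M : Set E3) (s : ℝ), SequentiallyGenerates β (periodize P) M →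
        IsLeast (meshEdgeLengths M) s →
      -- every execution terminates
      (∀ run : ℕ → Config, run 0 = start (periodize P) →
        ¬ ∀ k, ParallelStep β L s₀ (run k) (run (k + 1))) ∧
      ∀ c, Relation.ReflTransGen (ParallelStep β L s₀) (start (periodize P)) c →
        -- at most `C log² (L / s)` parallel rounds are executed
        (c.rounds : ℝ) ≤ C * Real.log (L / s) ^ 2 ∧
        -- an execution stops only when the outer loop is finished
        (¬ Halted β L s₀ c → ∃ d, ParallelStep β L s₀ c d) ∧
        -- the mesh is then of bounded radius-edge ratio
        (Halted β L s₀ c → HasRadiusEdgeBound β c.points) := by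
  have hb0 : 0 < Real.log β := Real.log_pos hβ
  have h20 : 0 < Real.log 2 := Real.log_pos one_lt_two
  refine ⟨3 / Real.log β * (4913 * (1 / Real.log 2 + 1 / Real.log β) + 1 / Real.log β),
    by positivity, fun P hfin hne _ L _ hL s₀ hs₀ M s hM hs => ?_⟩
  have hin : IsInput L s₀ (periodize P) := ⟨isPeriodicPointSet_periodize hfin hne, hL, hs₀⟩
  refine ⟨fun run h0 => hin.not_infinite_run hβ h0, fun c hc => ?_⟩
  have hinv := hin.invariant hβ hc
  refine ⟨?_, hinv.exists_step, hinv.hasRadiusEdgeBound hin hβ⟩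
  -- Without any round `β * s₀ < L` may fail, but then the bound is trivial.
  rcases Nat.eq_zero_or_pos c.rounds with h0 | h0
  · rw [h0, Nat.cast_zero]
    positivity
  have hβL := hinv.lt_of_rounds_pos h0
  have hs0 : 0 < s := pos_of_mem_meshEdgeLengths hs.1
  have hss : s ≤ s₀ := hM.shortest_le hβ hin.toIsPeriodicPointSet hs₀ hs
  have hlog : Real.log (L / s₀) ≤ Real.log (L / s) :=
    Real.log_le_log (div_pos hin.upper_pos hin.pos)
      (div_le_div_of_nonneg_left hin.upper_pos.le hs0 hss)
  have hlog0 : 0 ≤ Real.log (L / s₀) :=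
    Real.log_nonneg ((one_le_div hin.pos).2 (by nlinarith [hin.pos]))
  calc (c.rounds : ℝ) ≤ ((numClasses β L s₀ + 1) * (roundBound L s₀ + 1) : ℕ) := by
        exact_mod_cast hinv.rounds_le
    _ ≤ _ := numClasses_mul_roundBound_le hβ hin.pos hβL
    _ ≤ _ := by gcongr
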